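/- Let $\mathcal A$ be a complex unital $*$-algebra and let $Z:\mathcal A\to\mathbb C$ be a linear functional which is hermitian ($Z(a^*)=\overline{Z(a)}$) and satisfies $Z(1)=1$. A Krein space is a complex vector space $\mathcal K$ with an indefinite inner product of the form $[\xi,\eta]=\langle J\xi,\eta\rangle$, where $\langle\cdot,\cdot\rangle$ is a positive inner product making $\mathcal K$ a Hilbert space and $J=J^*=J^{-1}$ is bounded; $T^\sharp$ denotes the adjoint of a densely defined operator $T$ with respect to $[\cdot,\cdot]$. GNS data $(\pi,\mathcal K,\Omega)$ for $Z$ consist of a Krein space $\mathcal K$, a linear map $\pi$ from $\mathcal A$ to the closable operators defined on a common dense linear domain $\mathcal D(\pi)\subset\mathcal K$, and a vector $\Omega\in\mathcal D(\pi)$, such that $\pi(a)\mathcal D(\pi)\subset\mathcal D(\pi)$, $\pi(ab)=\pi(a)\pi(b)$, $\mathcal D(\pi)\subset\operatorname{dom}\pi(a)^\sharp$ and $\pi(a)^\sharp|_{\mathcal D(\pi)}=\pi(a^*)$ for all $a,b\in\mathcal A$, $Z(a)=[\pi(a)\Omega,\Omega]$ for all $a\in\mathcal A$, and $\mathcal D(\pi)$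 is the linear span (without closure) of $\{\pi(a)\Omega : a\in\mathcal A\}$. The GNS data are bounded if every $\pi(a)$ is a bounded operator on $\mathcal D(\pi)$. A function $L:\mathcal A\times\mathcal A\to\mathbb C$ is a positive definite scalar kernel if $L(x,y)=\overline{L(y,x)}$ for all $x,y$ and $\sum_{x,y}L(x,y)f(y)\overline{f(x)}\ge 0$ for every finitely supported $f:\mathcal A\to\mathbb C$. Theorem. $Z$ admits bounded GNS data if and only if there exists a positive definite scalar kernel $L$ on $\mathcal A$ such that $$\Bigl|Z\Bigl(\sum_{i,j=1}^n\lambda_i\overline{\lambda}_j\,x_ix_j^*\Bigr)\Bigr|\le\sum_{i,j=1}^n\lambda_i\overline{\lambda}_j\,L(x_i,x_j)$$ for all $n\in\mathbb N$, $\{\lambda_i\}_{i=1}^n\subset\mathbb C$, $\{x_i\}_{i=1}^n\subset\mathcal A$, and such that for every $a\in\mathcal A$ there exists $C_a>0$ with $$\sum_{i,j=1}^n\lambda_i\overline{\lambda}_j\,L(x_ia^*,x_ja^*)\le C_a\sum_{i,j=1}^n\lambda_i\overline{\lambda}_j\,L(x_i,x_j)$$ for all $n\in\mathbb N$, $\{\lambda_i\}_{i=1}^n\subset\mathbb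 C$, $\{x_i\}_{i=1}^n\subset\mathcal A$. -/

import Mathlib

open scoped ComplexConjugate ComplexOrder

universe u v

/-- A Krein space: a complex vector space carrying a Hilbert space structure (one of its unitary
norms) together with a fundamental symmetry `J`, i.e. `J = J* = J⁻¹`. The indefinite inner
product is `kreinInner`. -/
class KreinSpace (K : Type*) [NormedAddCommGroup K] [InnerProductSpace ℂ K]
    [CompleteSpace K] where
  /-- The fundamental symmetry. -/
  J : K →L[ℂ] K
  adjoint_J : ContinuousLinearMap.adjoint J = J
  J_comp_J : J ∘L J = ContinuousLinearMap.id ℂ K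

section Krein

variable {K : Type*} [NormedAddCommGroup K] [InnerProductSpace ℂ K] [CompleteSpace K]
  [KreinSpace K]

/-- The indefinite inner product `[x, y] = ⟨J x, y⟩` of a Krein space, linear in `x` and
antilinear in `y` (Mathlib's `inner` is antilinear in its first argument). -/
noncomputable def kreinInner (x y : K) : ℂ := inner ℂ y (KreinSpace.J x)

/-- For an operator `T` in a Krein space (densely defined), `y` lies in the domain of the
Krein space adjoint `T♯` and `T♯ y = z`. -/
def IsKreinAdjointAt (T : K →ₗ.[ℂ] K) (y z : K) : Prop :=
  ∀ x : T.domain, kreinInner (T x) y = kreinInner (x : K) z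

end Krein

/-- A hermitian closable representation of a complex `*`-algebra `A` on a Krein space `K`. -/
structure HermitianClosableRep (A : Type*) [Ring A] [StarRing A] [Algebra ℂ A]
    (K : Type*) [NormedAddCommGroup K] [InnerProductSpace ℂ K] [CompleteSpace K]
    [KreinSpace K] where
  /-- The common domain of the operators. -/
  D : Submodule ℂ K
  dense_D : Dense (D : Set K)
  /-- The representation, linear and multiplicative; each `π a` maps `D` into itself. -/
  π : A →ₙₐ[ℂ] Module.End ℂ D
  closable : ∀ a : A, (LinearPMap.mk D (D.subtype ∘ₗ π a)).IsClosable
  /-- The domain of `(π a)♯` contains `D`, and `(π a)♯` restricted to `D` is `π (a*)`. -/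
  adjoint_eq : ∀ (a : A) (y : D),
    IsKreinAdjointAt (LinearPMap.mk D (D.subtype ∘ₗ π a)) (y : K) (π (star a) y : K)

/-- GNS data on the Krein space `K` associated to a linear functional `Z`. -/
structure GNSData {A : Type*} [Ring A] [StarRing A] [Algebra ℂ A] (Z : A →ₗ[ℂ] ℂ)
    (K : Type*) [NormedAddCommGroup K] [InnerProductSpace ℂ K] [CompleteSpace K]
    [KreinSpace K] extends HermitianClosableRep A K where
  /-- The cyclic vector. -/
  Ω : D
  functional_eq : ∀ a : A, Z a = kreinInner (π a Ω : K) (Ω : K)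
  /-- The linear span (without closure) of the vectors `π a Ω` is the whole domain. -/
  cyclic : Submodule.span ℂ (Set.range fun a : A => (π a Ω : K)) = D

/-- GNS data are bounded if every operator `π a` is bounded. -/
def GNSData.IsBounded {A : Type*} [Ring A] [StarRing A] [Algebra ℂ A] {Z : A →ₗ[ℂ] ℂ}
    {K : Type*} [NormedAddCommGroup K] [InnerProductSpace ℂ K] [CompleteSpace K]
    [KreinSpace K] (G : GNSData Z K) : Prop :=
  ∀ a : A, ∃ C : ℝ, ∀ x : G.D, ‖(G.π a x : K)‖ ≤ C * ‖(x : K)‖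

/-- `Z` admits bounded GNS data on some Krein space. The universe `max u v` of that space, with
`v` free, is arbitrary among those containing (a copy of) the algebra. -/
def AdmitsBoundedGNSData {A : Type u} [Ring A] [StarRing A] [Algebra ℂ A]
    (Z : A →ₗ[ℂ] ℂ) : Prop :=
  ∃ (K : Type (max u v)) (_ : NormedAddCommGroup K) (_ : InnerProductSpace ℂ K)
    (_ : CompleteSpace K) (_ : KreinSpace K) (G : GNSData Z K), G.IsBounded

/-- A scalar kernel `L` is positive definite: it is hermitian, `L x y = conj (L y x)`, and
`∑ x y, L x y * f y * conj (f x) ≥ 0` for every finitely supported function `f`. -/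
def IsPosDefKernel {X : Type*} (L : X → X → ℂ) : Prop :=
  (Matrix.of L).PosSemidef

/-- The Schwartz-type bound of `Z` by the scalar kernel `L`. The sum on the right is real
when `L` is hermitian. -/
def SchwartzBound {A : Type*} [Ring A] [StarRing A] [Algebra ℂ A]
    (Z : A →ₗ[ℂ] ℂ) (L : A → A → ℂ) : Prop :=
  ∀ (n : ℕ) (c : Fin n → ℂ) (x : Fin n → A),
    ‖Z (∑ i, ∑ j, (c i * conj (c j)) • (x i * star (x j)))‖ ≤
      (∑ i, ∑ j, c i * conj (c j) * L (x i) (x j)).re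

/-! Given bounded data, the kernel `L(x, y) = ⟨π(y*)Ω, π(x*)Ω⟩` works: `Z(XX*) = [π(X*)Ω, π(X*)Ω]`,
a Krein form is dominated by its Hilbert norm, and `xa*` corresponds to applying `π(a)`. Conversely,
`L(x*, y*)` is the Gram kernel of vectors in a Hilbert space `H`. The Schwartz bound makes `Z(x*y)`
a bounded form on `H`, hence given by a self-adjoint `G`. The second inequality makes left
multiplication by `a` a bounded operator `τ a` with `G * τ a = star (τ (star a)) * G`. The Krein
space is the closure of the range of `|G|^{1/2}`, with the sign of `G` as `J`. The crux is that `τ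
a` stays bounded for the norm `‖|G|^{1/2} x‖`, which follows from the intertwining relation and
operator monotonicity of the square root (`CStarAlgebra.star_mul_abs_mul_le`). -/

section CStar

variable {B : Type*} [CStarAlgebra B] [PartialOrder B] [StarOrderedRing B]

/-- If `g` is self-adjoint and `g * t = star s * g`, then `t` is bounded for the seminorm
defined by `|g|`. -/
theorem CStarAlgebra.star_mul_abs_mul_le {g t s : B} (hg : IsSelfAdjoint g)
    (h : g * t = star s * g) :
    star t * CFC.abs g * t ≤ (‖t‖ * ‖s‖) • CFC.abs g := by
  have hpos : 0 ≤ star t * CFC.abs g * t := star_left_conjugate_nonneg (CFC.abs_nonneg g) t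
  have habs : star (CFC.abs g) = CFC.abs g := (CFC.abs_nonneg g).isSelfAdjoint
  have h1 : ∀ x : B, x * star x ≤ (‖x‖ ^ 2) • (1 : B) := fun x => by
    have h2 := (IsSelfAdjoint.mul_star_self x).le_algebraMap_norm_self
    rwa [CStarRing.norm_self_mul_star, Algebra.algebraMap_eq_smul_one, ← sq] at h2
  -- Squaring replaces `|g|²` by `g²`, to which the intertwining relation applies; the square root,
  -- being operator monotone, then undoes the squaring.
  have h3 : (star t * CFC.abs g * t) * (star t * CFC.abs g * t)
      ≤ ((‖t‖ * ‖s‖) • g) * ((‖t‖ * ‖s‖) • g) := by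
    calc (star t * CFC.abs g * t) * (star t * CFC.abs g * t)
        = star (CFC.abs g * t) * (t * star t) * (CFC.abs g * t) := by
          rw [star_mul, habs]; simp only [mul_assoc]
      _ ≤ star (CFC.abs g * t) * ((‖t‖ ^ 2) • (1 : B)) * (CFC.abs g * t) :=
          star_left_conjugate_le_conjugate (h1 t) _
      _ = (‖t‖ ^ 2) • (star t * (CFC.abs g * CFC.abs g) * t) := by
          rw [star_mul, habs]; simp [mul_assoc]
      _ = (‖t‖ ^ 2) • (star g * (s * star s) * g) := by
          rw [CFC.abs_mul_abs]
          have : star t * (star g * g) * t = star (g * t) * (g * t) := by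
            rw [star_mul]; simp only [mul_assoc]
          rw [this, h, star_mul, star_star]; simp only [mul_assoc]
      _ ≤ (‖t‖ ^ 2) • (star g * ((‖s‖ ^ 2) • (1 : B)) * g) :=
          smul_le_smul_of_nonneg_left (star_left_conjugate_le_conjugate (h1 s) _) (by positivity)
      _ = _ := by
          rw [hg.star_eq]
          simp only [mul_smul_comm, smul_mul_assoc, mul_one, smul_smul]
          congr 1; ring
  have h4 := CFC.sqrt_le_sqrt _ _ h3
  rw [CFC.sqrt_mul_self _ hpos] at h4
  refine h4.trans_eq ?_
  have hsa : IsSelfAdjoint ((‖t‖ * ‖s‖) • g) := (IsSelfAdjoint.all _).smul hg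
  have : ((‖t‖ * ‖s‖) • g) * ((‖t‖ * ‖s‖) • g)
      = star ((‖t‖ * ‖s‖) • g) * ((‖t‖ * ‖s‖) • g) := by rw [hsa.star_eq]
  rw [this]
  refine CFC.sqrt_unique ?_ (smul_nonneg (by positivity) (CFC.abs_nonneg g))
  rw [hsa.star_eq, smul_mul_smul_comm, CFC.abs_mul_abs, hg.star_eq, smul_mul_smul_comm]

end CStar

/-! ### The Krein space of a bounded self-adjoint operator -/

section Hilbert

variable {H : Type*} [NormedAddCommGroup H] [InnerProductSpace ℂ H] [CompleteSpace H]

theorem ContinuousLinearMap.exists_norm_sqrt_abs_apply_le {G T S : H →L[ℂ] H}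
    (hG : IsSelfAdjoint G) (h : G * T = star S * G) :
    ∃ C : ℝ, 0 ≤ C ∧ ∀ x, ‖CFC.sqrt (CFC.abs G) (T x)‖ ≤ C * ‖CFC.sqrt (CFC.abs G) x‖ := by
  have key := CStarAlgebra.star_mul_abs_mul_le hG h
  have hsq : ∀ x, ‖CFC.sqrt (CFC.abs G) x‖ ^ 2 = (inner ℂ x (CFC.abs G x)).re := fun x => by
    have hsa : IsSelfAdjoint (CFC.sqrt (CFC.abs G)) := (CFC.sqrt_nonneg _).isSelfAdjoint
    have h1 := CFC.sqrt_mul_sqrt_self _ (CFC.abs_nonneg G)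
    conv_rhs => rw [← h1]
    rw [mul_apply_eq_comp, ← ContinuousLinearMap.adjoint_inner_left,
      ← ContinuousLinearMap.star_eq_adjoint, hsa.star_eq, inner_self_eq_norm_sq_to_K]
    norm_cast
  refine ⟨√(‖T‖ * ‖S‖), Real.sqrt_nonneg _, fun x => ?_⟩
  refine le_of_sq_le_sq ?_ (by positivity)
  rw [mul_pow, Real.sq_sqrt (by positivity), hsq, hsq]
  have h2 := ((ContinuousLinearMap.le_def _ _).1 key).re_inner_nonneg_right x
  simp only [sub_apply, inner_sub_right, map_sub, sub_nonneg,
    mul_apply_eq_comp, smul_apply,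
    ContinuousLinearMap.star_eq_adjoint, ContinuousLinearMap.adjoint_inner_right] at h2
  rw [← Complex.coe_smul, inner_smul_right] at h2
  simpa using h2

/-- A self-adjoint operator is the product of its absolute value and a commuting symmetry. -/
theorem ContinuousLinearMap.exists_symmetry_mul_abs {G : H →L[ℂ] H} (hG : IsSelfAdjoint G) :
    ∃ S : H →L[ℂ] H, IsSelfAdjoint S ∧ S * S = 1 ∧ S * CFC.abs G = G ∧
      Commute S (CFC.sqrt (CFC.abs G)) := by
  -- The symmetry is the reflection in the closed range of `G⁺`: it fixes `G⁺` and negates `G⁻`,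
  -- because `G⁺G⁻ = 0`.
  set P := (LinearMap.range (G⁺ : H →L[ℂ] H).toLinearMap).topologicalClosure with hP
  have : CompleteSpace P := (Submodule.isClosed_topologicalClosure _).completeSpace_coe
  set S : H →L[ℂ] H := (P.reflection : H →L[ℂ] H) with hS
  have hSap : ∀ x, S x = P.reflection x := fun _ => rfl
  have hSsa : IsSelfAdjoint S := by
    rw [ContinuousLinearMap.isSelfAdjoint_iff_isSymmetric]
    intro x y
    change inner ℂ (P.reflection x) y = inner ℂ x (P.reflection y)
    rw [← P.reflection.inner_map_map, P.reflection_reflection]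
  have hSS : S * S = 1 := by ext x; simp [hSap]
  have hpos : IsSelfAdjoint (G⁺ : H →L[ℂ] H) := (CFC.posPart_nonneg G).isSelfAdjoint
  have hp : S * G⁺ = G⁺ := by
    ext x
    exact P.reflection_mem_subspace_eq_self (Submodule.le_topologicalClosure _ ⟨x, rfl⟩)
  have hn : S * G⁻ = -G⁻ := by
    ext x
    refine P.reflection_mem_subspace_orthogonalComplement_eq_neg ?_
    rw [hP, Submodule.orthogonal_closure, Submodule.mem_orthogonal]
    rintro _ ⟨y, rfl⟩
    change inner ℂ (G⁺ y) (G⁻ x) = 0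
    rw [← ContinuousLinearMap.adjoint_inner_right, ← ContinuousLinearMap.star_eq_adjoint,
      hpos.star_eq, ← mul_apply_eq_comp, CFC.posPart_mul_negPart]
    simp
  have hSG : S * CFC.abs G = G := by
    rw [← CFC.posPart_add_negPart G hG, mul_add, hp, hn, ← sub_eq_add_neg,
      CFC.posPart_sub_negPart G hG]
  have hGS : CFC.abs G * S = G := by
    have := congrArg star hSG
    rwa [star_mul, hSsa.star_eq, hG.star_eq, (CFC.abs_nonneg G).isSelfAdjoint.star_eq] at this
  refine ⟨S, hSsa, hSS, hSG, ?_⟩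
  have hc : Commute (CFC.abs G) S := hGS.trans hSG.symm
  rw [CFC.sqrt_eq_cfc]
  exact (hc.cfc_nnreal _).symm

/-- Every bounded self-adjoint operator `G` on a Hilbert space induces a Krein space. -/
theorem exists_kreinSpace_of_isSelfAdjoint {H : Type u} [NormedAddCommGroup H]
    [InnerProductSpace ℂ H] [CompleteSpace H] {G : H →L[ℂ] H} (hG : IsSelfAdjoint G) :
    ∃ (K : Type u) (_ : NormedAddCommGroup K) (_ : InnerProductSpace ℂ K)
      (_ : CompleteSpace K) (_ : KreinSpace K) (W : H →L[ℂ] K), DenseRange W ∧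
      (∀ x y, kreinInner (W x) (W y) = inner ℂ y (G x)) ∧
      ∀ T S : H →L[ℂ] H, G * T = star S * G → ∃ C : ℝ, 0 ≤ C ∧ ∀ x, ‖W (T x)‖ ≤ C * ‖W x‖ := by
  obtain ⟨S, hS, hSS, hSG, hSR⟩ := ContinuousLinearMap.exists_symmetry_mul_abs hG
  set R := CFC.sqrt (CFC.abs G) with hR
  have hRsa : IsSelfAdjoint R := (CFC.sqrt_nonneg _).isSelfAdjoint
  have hRR : R * R = CFC.abs G := CFC.sqrt_mul_sqrt_self _ (CFC.abs_nonneg G)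
  -- Passing to the closed range of `R` discards the kernel of `G`; `S` preserves this subspace
  -- since it commutes with `R`.
  set K := (LinearMap.range R.toLinearMap).topologicalClosure with hK
  have hcK : CompleteSpace K := (Submodule.isClosed_topologicalClosure _).completeSpace_coe
  have hRK : ∀ x, R x ∈ K := fun x => Submodule.le_topologicalClosure _ ⟨x, rfl⟩
  have hSK : ∀ x ∈ K, S x ∈ K := by
    have : Set.MapsTo S (LinearMap.range R.toLinearMap : Set H) (LinearMap.range R.toLinearMap) := by
      rintro _ ⟨y, rfl⟩
      exact ⟨S y, (DFunLike.congr_fun hSR.eq y).symm⟩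
    exact this.closure S.continuous
  let J : K →L[ℂ] K := (S ∘L K.subtypeL).codRestrict K fun x => hSK _ x.2
  have hSS' : ∀ x, S (S x) = x := fun x => DFunLike.congr_fun hSS x
  have hSsym := (ContinuousLinearMap.isSelfAdjoint_iff_isSymmetric.1 hS)
  have hRsym := (ContinuousLinearMap.isSelfAdjoint_iff_isSymmetric.1 hRsa)
  let kr : KreinSpace K :=
    { J := J
      adjoint_J := by
        rw [← ContinuousLinearMap.star_eq_adjoint]
        exact ContinuousLinearMap.isSelfAdjoint_iff_isSymmetric.2 fun x y => hSsym x y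
      J_comp_J := by ext x; exact hSS' x }
  refine ⟨K, inferInstance, inferInstance, hcK, kr, R.codRestrict K hRK, ?_, ?_, ?_⟩
  · intro x
    rw [Metric.mem_closure_iff]
    intro ε hε
    obtain ⟨_, ⟨y, rfl⟩, hy⟩ := Metric.mem_closure_iff.1 x.2 ε hε
    exact ⟨_, ⟨y, rfl⟩, hy⟩
  · intro x y
    change inner ℂ (R y) (S (R x)) = _
    rw [show inner ℂ (R y) (S (R x)) = inner ℂ y (R (S (R x))) from hRsym _ _]
    congr 1
    rw [← hSG, ← hRR]
    exact DFunLike.congr_fun hSR.eq.symm (R x)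
  · intro T S h
    exact ContinuousLinearMap.exists_norm_sqrt_abs_apply_le hG h

end Hilbert

/-! ### GNS data from a linear map, and Kolmogorov decomposition -/

theorem ContinuousLinearMap.isClosable_domRestrict {K : Type*} [NormedAddCommGroup K]
    [NormedSpace ℂ K] (T : K →L[ℂ] K) (D : Submodule ℂ K) (f : D →ₗ[ℂ] K)
    (hf : ∀ x : D, f x = T x) : (LinearPMap.mk D f).IsClosable := by
  have hT : (T.toLinearMap.toPMap ⊤).IsClosed := by
    have : ((T.toLinearMap.toPMap ⊤).graph : Set (K × K)) = {p | T p.1 = p.2} := by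
      ext ⟨a, b⟩
      simp [LinearPMap.mem_graph_iff]
    rw [LinearPMap.IsClosed, this]
    exact isClosed_eq (by fun_prop) (by fun_prop)
  refine hT.isClosable.leIsClosable ⟨le_top, ?_⟩
  intro x y hxy
  change f x = T y
  rw [hf, hxy]

/-- The bound lets left multiplication descend through `w` and extend continuously to `K`; the
domain is the range of `w`, and the cyclic vector is `w 1`. -/
theorem exists_gnsData_of_linearMap {A : Type*} [Ring A] [StarRing A] [Algebra ℂ A]
    {Z : A →ₗ[ℂ] ℂ} {K : Type*} [NormedAddCommGroup K] [InnerProductSpace ℂ K]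
    [CompleteSpace K] [KreinSpace K] (w : A →ₗ[ℂ] K) (hw : DenseRange w)
    (hZ : ∀ x y, kreinInner (w x) (w y) = Z (star y * x))
    (hb : ∀ a, ∃ C : ℝ, ∀ x, ‖w (a * x)‖ ≤ C * ‖w x‖) :
    ∃ G : GNSData Z K, G.IsBounded := by
  let T : A → K →L[ℂ] K := fun a => (w ∘ₗ LinearMap.mulLeft ℂ a).extendOfNorm w
  have hT : ∀ a x, T a (w x) = w (a * x) := fun a x => LinearMap.extendOfNorm_eq hw (hb a) x
  have hTD : ∀ a, ∀ x ∈ LinearMap.range w, (T a).toLinearMap x ∈ LinearMap.range w := by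
    rintro a _ ⟨x, rfl⟩
    exact ⟨a * x, (hT a x).symm⟩
  let p : A → Module.End ℂ (LinearMap.range w) := fun a => (T a).toLinearMap.restrict (hTD a)
  have hp : ∀ a x, p a (w.rangeRestrict x) = w.rangeRestrict (a * x) :=
    fun a x => Subtype.ext (hT a x)
  have hext : ∀ f g : Module.End ℂ (LinearMap.range w),
      (∀ x, f (w.rangeRestrict x) = g (w.rangeRestrict x)) → f = g := fun f g h =>
    LinearMap.ext fun d => by
      obtain ⟨x, rfl⟩ := w.surjective_rangeRestrict d
      exact h x
  let G : GNSData Z K :=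
    { D := LinearMap.range w
      dense_D := hw
      π :=
        { toFun := p
          map_smul' := fun c a => hext _ _ fun x => by
            simp only [hp, smul_mul_assoc, map_smul, LinearMap.smul_apply, MonoidHom.id_apply]
          map_zero' := hext _ _ fun x => by
            rw [hp, zero_mul, map_zero, LinearMap.zero_apply]
          map_add' := fun a b => hext _ _ fun x => by
            simp only [hp, add_mul, map_add, LinearMap.add_apply]
          map_mul' := fun a b => hext _ _ fun x => by
            simp only [hp, mul_assoc, Module.End.mul_apply] }
      closable := fun a => (T a).isClosable_domRestrict _ _ fun x => rfl
      adjoint_eq := by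
        rintro a ⟨_, y, rfl⟩ ⟨_, x, rfl⟩
        change kreinInner (T a (w x)) (w y) = kreinInner (w x) (T (star a) (w y))
        rw [hT, hT, hZ, hZ, star_mul, star_star, mul_assoc]
      Ω := ⟨w 1, 1, rfl⟩
      functional_eq := by
        intro a
        change Z a = kreinInner (T a (w 1)) (w 1)
        rw [hT, hZ, star_one, one_mul, mul_one]
      cyclic := by
        have : (Set.range fun a : A => T a (w 1)) = LinearMap.range w := by
          ext y
          simp [hT]
        change Submodule.span ℂ (Set.range fun a : A => T a (w 1)) = _
        rw [this, Submodule.span_eq] }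
  refine ⟨G, fun a => ?_⟩
  obtain ⟨C, hC⟩ := hb a
  refine ⟨C, ?_⟩
  rintro ⟨_, x, rfl⟩
  exact (congrArg norm (hT a x)).trans_le (hC x)

/-- Kolmogorov decomposition of a positive definite scalar kernel. -/
theorem Matrix.PosSemidef.exists_hilbert {X : Type u} {M : Matrix X X ℂ} (hM : M.PosSemidef) :
    ∃ (H : Type u) (_ : NormedAddCommGroup H) (_ : InnerProductSpace ℂ H) (_ : CompleteSpace H)
      (k : X → H), (Submodule.span ℂ (Set.range k)).topologicalClosure = ⊤ ∧
      ∀ x y, inner ℂ (k x) (k y) = M x y := by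
  -- The scalar kernel is viewed as an operator-valued one on `ℂ`, so that `H` is its reproducing
  -- kernel space.
  let N : Matrix X X (ℂ →L[ℂ] ℂ) := Matrix.of fun x y => M x y • (1 : ℂ →L[ℂ] ℂ)
  have hN : N.PosSemidef := by
    have h := (RKHS.posSemidef_tfae (K := N)).out 0 2
    refine h.2 ⟨?_, fun f => ?_⟩
    · ext x y
      have := hM.isHermitian.apply x y
      simp [N, ← this]
    · have := (Complex.nonneg_iff.1 (hM.2 f)).1
      refine this.trans_eq (congrArg Complex.re (Finset.sum_congr rfl fun i _ =>
        Finset.sum_congr rfl fun j _ => ?_))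
      change star (f i) * M i j * f j = inner ℂ (N j i (f i)) (f j)
      rw [← hM.isHermitian.apply i j]
      simp [N]
      ring
  have : Fact N.PosSemidef := ⟨hN⟩
  refine ⟨RKHS.OfKernel N, inferInstance, inferInstance, inferInstance,
    fun x => RKHS.kerFun (RKHS.OfKernel N) x (1 : ℂ), ?_, fun x y => ?_⟩
  · rw [← RKHS.kerFun_dense (RKHS.OfKernel N)]
    congr 1
    refine le_antisymm (Submodule.span_mono ?_) (Submodule.span_le.2 ?_)
    · rintro _ ⟨x, rfl⟩
      exact ⟨x, 1, rfl⟩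
    · rintro _ ⟨x, c, rfl⟩
      have : RKHS.kerFun (RKHS.OfKernel N) x c = c • RKHS.kerFun (RKHS.OfKernel N) x (1 : ℂ) := by
        rw [← map_smul, smul_eq_mul, mul_one]
      rw [this]
      exact Submodule.smul_mem _ _ (Submodule.subset_span ⟨x, rfl⟩)
  · rw [← RKHS.kernel_inner, RKHS.OfKernel.kernel_ofKernel, ← hM.isHermitian.apply]
    simp [N]

/-! ### Sesquilinear forms dominated by a Hilbert seminorm -/

section Form

variable {V : Type*} [AddCommGroup V] [Module ℂ V] {H : Type*} [NormedAddCommGroup H]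
  [InnerProductSpace ℂ H]

/-- A sesquilinear form whose quadratic form is dominated by a Hilbertian seminorm is bounded. -/
theorem LinearMap.norm_apply_le_of_norm_apply_self_le (B : V →ₗ⋆[ℂ] V →ₗ[ℂ] ℂ) (e : V →ₗ[ℂ] H)
    (hB : ∀ f, ‖B f f‖ ≤ ‖e f‖ ^ 2) (f g : V) : ‖B f g‖ ≤ 2 * ‖e f‖ * ‖e g‖ := by
  have h1 : ∀ f g, ‖B f g‖ ≤ ‖e f‖ ^ 2 + ‖e g‖ ^ 2 := by
    intro f g
    have hpol : 4 * B f g = (B (f + g) (f + g) - B (f - g) (f - g))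
        - Complex.I * (B (f + Complex.I • g) (f + Complex.I • g)
          - B (f - Complex.I • g) (f - Complex.I • g)) := by
      simp only [map_add, map_sub, LinearMap.add_apply, LinearMap.sub_apply, map_smul,
        LinearMap.map_smulₛₗ, LinearMap.smul_apply, smul_eq_mul, Complex.conj_I]
      linear_combination (2 * B f g - 2 * B g f) * Complex.I_sq
    have n1 := parallelogram_law_with_norm ℂ (e f) (e g)
    have n2 := parallelogram_law_with_norm ℂ (e f) (Complex.I • e g)
    have b1 := hB (f + g)
    have b2 := hB (f - g)
    have b3 := hB (f + Complex.I • g)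
    have b4 := hB (f - Complex.I • g)
    simp only [map_add, map_sub, map_smul] at b1 b2 b3 b4
    simp only [norm_smul, Complex.norm_I, one_mul] at n2
    have h4 : ‖4 * B f g‖ = 4 * ‖B f g‖ := by simp
    have t1 := norm_sub_le (B (f + g) (f + g) - B (f - g) (f - g))
      (Complex.I * (B (f + Complex.I • g) (f + Complex.I • g)
          - B (f - Complex.I • g) (f - Complex.I • g)))
    have t2 := norm_sub_le (B (f + g) (f + g)) (B (f - g) (f - g))
    have t3 := norm_sub_le (B (f + Complex.I • g) (f + Complex.I • g))
      (B (f - Complex.I • g) (f - Complex.I • g))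
    rw [← hpol, h4, norm_mul, Complex.norm_I, one_mul] at t1
    simp only [map_add, map_sub, map_smul] at *
    nlinarith
  -- Rescaling by strict upper bounds rather than by the norms themselves allows `e f` or `e g` to
  -- vanish; `h5` then lets the excess tend to zero.
  have h2 : ∀ a : ℝ, 0 < a → ∀ b : ℝ, 0 < b → ‖e f‖ ≤ a → ‖e g‖ ≤ b →
      ‖B f g‖ ≤ 2 * a * b := by
    intro a ha b hb hfa hgb
    have h3 := h1 (((a⁻¹ : ℝ) : ℂ) • f) (((b⁻¹ : ℝ) : ℂ) • g)
    have hf1 : ‖e (((a⁻¹ : ℝ) : ℂ) • f)‖ ≤ 1 := by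
      rw [map_smul, norm_smul, Complex.norm_real, Real.norm_of_nonneg (by positivity)]
      exact inv_mul_le_one_of_le₀ hfa ha.le
    have hg1 : ‖e (((b⁻¹ : ℝ) : ℂ) • g)‖ ≤ 1 := by
      rw [map_smul, norm_smul, Complex.norm_real, Real.norm_of_nonneg (by positivity)]
      exact inv_mul_le_one_of_le₀ hgb hb.le
    have hf2 := pow_le_one₀ (n := 2) (norm_nonneg _) hf1
    have hg2 := pow_le_one₀ (n := 2) (norm_nonneg _) hg1
    simp only [LinearMap.map_smulₛₗ, LinearMap.smul_apply, map_smul, norm_smul, Complex.norm_real,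
      Complex.conj_ofReal,
      Real.norm_of_nonneg (inv_nonneg.2 ha.le), Real.norm_of_nonneg (inv_nonneg.2 hb.le)] at h3 hf2 hg2
    have h4 : a⁻¹ * (b⁻¹ * ‖B f g‖) ≤ 2 := by linarith
    calc ‖B f g‖ = a * b * (a⁻¹ * (b⁻¹ * ‖B f g‖)) := by field_simp
      _ ≤ a * b * 2 := by gcongr
      _ = _ := by ring
  have h5 : Filter.Tendsto (fun ε : ℝ => 2 * (‖e f‖ + ε) * (‖e g‖ + ε)) (nhdsWithin 0 (Set.Ioi 0))
      (nhds (2 * ‖e f‖ * ‖e g‖)) := by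
    have : Continuous fun ε : ℝ => 2 * (‖e f‖ + ε) * (‖e g‖ + ε) := by fun_prop
    have := (this.tendsto 0).mono_left (nhdsWithin_le_nhds (s := Set.Ioi 0))
    simpa using this
  refine ge_of_tendsto h5 ?_
  filter_upwards [self_mem_nhdsWithin] with ε hε
  have hε : (0 : ℝ) < ε := hε
  exact h2 _ (by positivity) _ (by positivity) (by linarith) (by linarith)

/-- Riesz representation is applied to each `B f`, then the resulting map is extended through `e`;
boundedness also makes both independent of representatives. -/
theorem LinearMap.exists_isSelfAdjoint_inner_eq [CompleteSpace H] (B : V →ₗ⋆[ℂ] V →ₗ[ℂ] ℂ)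
    (e : V →ₗ[ℂ] H) (he : DenseRange e) (hB : ∀ f, ‖B f f‖ ≤ ‖e f‖ ^ 2)
    (hsymm : ∀ f g, B f g = conj (B g f)) :
    ∃ G : H →L[ℂ] H, IsSelfAdjoint G ∧ ∀ f g, inner ℂ (e f) (G (e g)) = B f g := by
  have hle := B.norm_apply_le_of_norm_apply_self_le e hB
  have hex : ∀ f, ∃ b : H, ‖b‖ ≤ 2 * ‖e f‖ ∧ ∀ g, inner ℂ b (e g) = B f g := by
    intro f
    let φ : H →L[ℂ] ℂ := (B f).extendOfNorm e
    have hφ : ∀ g, φ (e g) = B f g := fun g => LinearMap.extendOfNorm_eq he ⟨_, hle f⟩ g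
    refine ⟨(InnerProductSpace.toDual ℂ H).symm φ, ?_, fun g => ?_⟩
    · rw [LinearIsometryEquiv.norm_map]
      exact φ.opNorm_le_bound (by positivity)
        fun x => LinearMap.norm_extendOfNorm_apply_le he _ (hle f) x
    · rw [InnerProductSpace.toDual_symm_apply, hφ]
  choose b hb1 hb2 using hex
  let bl : V →ₗ[ℂ] H :=
    { toFun := b
      map_add' := fun f f' => he.eq_of_inner_left ℂ fun g => by
        simp only [inner_add_left, hb2, map_add, LinearMap.add_apply]
      map_smul' := fun c f => he.eq_of_inner_left ℂ fun g => by
        simp only [inner_smul_left, hb2, LinearMap.map_smulₛₗ, LinearMap.smul_apply, smul_eq_mul,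
          RingHom.id_apply] }
  let G : H →L[ℂ] H := bl.extendOfNorm e
  have hG : ∀ f, G (e f) = b f := fun f => LinearMap.extendOfNorm_eq he ⟨_, hb1⟩ f
  refine ⟨G, ?_, fun f g => ?_⟩
  · rw [ContinuousLinearMap.isSelfAdjoint_iff_isSymmetric]
    intro x y
    change inner ℂ (G x) y = inner ℂ x (G y)
    refine he.induction_on₂ (p := fun x y => inner ℂ (G x) y = inner ℂ x (G y))
      (isClosed_eq (by fun_prop) (by fun_prop)) (fun f g => ?_) x y
    rw [hG, hG, hb2, ← inner_conj_symm, hb2, ← hsymm]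
  · rw [hG, ← inner_conj_symm, hb2, ← hsymm]

end Form

theorem norm_sum_smul_sq_eq_re_sum {H : Type*} [NormedAddCommGroup H] [InnerProductSpace ℂ H]
    {n : ℕ} (c : Fin n → ℂ) (k : Fin n → H) :
    ‖∑ i, c i • k i‖ ^ 2 = (∑ i, ∑ j, conj (c i) * c j * inner ℂ (k i) (k j)).re := by
  rw [← inner_self_eq_norm_sq (𝕜 := ℂ), sum_inner]
  simp only [inner_sum, inner_smul_left, inner_smul_right]
  refine congrArg Complex.re (Finset.sum_congr rfl fun i _ => Finset.sum_congr rfl fun j _ => ?_)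
  ring

theorem Finsupp.exists_eq_sum_fin_single {X : Type*} (f : X →₀ ℂ) :
    ∃ (n : ℕ) (c : Fin n → ℂ) (x : Fin n → X), f = ∑ i, Finsupp.single (x i) (c i) := by
  refine ⟨f.support.card, fun i => f (f.support.equivFin.symm i),
    fun i => f.support.equivFin.symm i, ?_⟩
  rw [f.support.equivFin.symm.sum_comp
    (fun x : f.support => Finsupp.single (x : X) (f x)),
    Finset.sum_coe_sort f.support fun x => Finsupp.single x (f x)]
  exact f.sum_single.symm

theorem Matrix.posSemidef_of_inner {X K : Type*} [NormedAddCommGroup K] [InnerProductSpace ℂ K]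
    (v : X → K) : (Matrix.of fun x y => inner ℂ (v x) (v y)).PosSemidef := by
  refine ⟨?_, fun f => ?_⟩
  · ext x y
    simp [Matrix.conjTranspose_apply]
  · have : (f.sum fun i a => f.sum fun j b => star a * inner ℂ (v i) (v j) * b)
        = inner ℂ (f.sum fun i a => a • v i) (f.sum fun i a => a • v i) := by
      rw [Finsupp.sum, Finsupp.sum, sum_inner]
      refine Finset.sum_congr rfl fun i _ => ?_
      rw [inner_sum]
      refine Finset.sum_congr rfl fun j _ => ?_
      simp only [RCLike.star_def, inner_smul_left, inner_smul_right]
      ring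
    simp only [Matrix.of_apply, this, inner_self_eq_norm_sq_to_K]
    norm_cast
    positivity

/-! ### Norm domination and nondegeneracy in a Krein space -/

section Krein

variable {K : Type*} [NormedAddCommGroup K] [InnerProductSpace ℂ K] [CompleteSpace K]
  [KreinSpace K]

theorem KreinSpace.J_J (x : K) : KreinSpace.J (KreinSpace.J x) = x :=
  DFunLike.congr_fun (KreinSpace.J_comp_J (K := K)) x

theorem KreinSpace.norm_J (x : K) : ‖KreinSpace.J x‖ = ‖x‖ := by
  have h : inner ℂ (KreinSpace.J x) (KreinSpace.J x) = inner ℂ x x := by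
    conv_lhs => rw [← ContinuousLinearMap.adjoint_inner_right, KreinSpace.adjoint_J, J_J]
  rw [inner_self_eq_norm_sq_to_K, inner_self_eq_norm_sq_to_K] at h
  exact (sq_eq_sq₀ (norm_nonneg _) (norm_nonneg _)).1 (by exact_mod_cast h)

theorem norm_kreinInner_self_le (x : K) : ‖kreinInner x x‖ ≤ ‖x‖ ^ 2 := by
  rw [kreinInner, sq]
  simpa [KreinSpace.norm_J] using norm_inner_le_norm (𝕜 := ℂ) x (KreinSpace.J x)

theorem eq_zero_of_kreinInner_eq_zero {ι : Type*} {e : ι → K} (he : DenseRange e) {x : K}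
    (h : ∀ i, kreinInner x (e i) = 0) : x = 0 := by
  have : KreinSpace.J x = 0 := he.eq_zero_of_inner_right ℂ h
  rw [← KreinSpace.J_J x, this, map_zero]

end Krein

/-! ### From bounded GNS data to a kernel -/

section Forward

variable {A : Type*} [Ring A] [StarRing A] [Algebra ℂ A] [StarModule ℂ A] {Z : A →ₗ[ℂ] ℂ}
  {K : Type*} [NormedAddCommGroup K] [InnerProductSpace ℂ K] [CompleteSpace K] [KreinSpace K]

theorem sum_smul_mul_star {n : ℕ} (c : Fin n → ℂ) (x : Fin n → A) :
    ∑ i, ∑ j, (c i * conj (c j)) • (x i * star (x j))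
      = (∑ i, c i • x i) * star (∑ i, c i • x i) := by
  simp only [star_sum, Finset.sum_mul, Finset.mul_sum, star_smul, smul_mul_smul_comm]
  rw [Finset.sum_comm]
  rfl

theorem GNSData.IsBounded.exists_kernel {G : GNSData Z K} (hG : G.IsBounded) :
    ∃ L : A → A → ℂ, IsPosDefKernel L ∧ SchwartzBound Z L ∧
      ∀ a : A, ∃ C : ℝ, 0 < C ∧ ∀ (n : ℕ) (c : Fin n → ℂ) (x : Fin n → A),
        (∑ i, ∑ j, c i * conj (c j) * L (x i * star a) (x j * star a)).re ≤
          C * (∑ i, ∑ j, c i * conj (c j) * L (x i) (x j)).re := by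
  let d : A → G.D := fun x => G.π (star x) G.Ω
  have hd : ∀ (n : ℕ) (c : Fin n → ℂ) (x : Fin n → A),
      d (∑ i, c i • x i) = ∑ i, conj (c i) • d (x i) := fun n c x => by
    simp [d, star_sum, star_smul, map_sum, map_smul, LinearMap.sum_apply]
  have hda : ∀ a x, d (x * star a) = G.π a (d x) := fun a x => by
    simp [d, star_mul]
  have hn : ∀ (n : ℕ) (c : Fin n → ℂ) (y : Fin n → G.D),
      (∑ i, ∑ j, c i * conj (c j) * inner ℂ (y i : K) (y j : K)).re
        = ‖((∑ i, conj (c i) • y i : G.D) : K)‖ ^ 2 := fun n c y => by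
    have := norm_sum_smul_sq_eq_re_sum (fun i => conj (c i)) (fun i => (y i : K))
    simp only [Complex.conj_conj] at this
    rw [← this]
    simp
  refine ⟨fun x y => inner ℂ (d x : K) (d y : K), Matrix.posSemidef_of_inner _, ?_, fun a => ?_⟩
  · intro n c x
    rw [hn n c fun i => d (x i), sum_smul_mul_star, ← hd]
    set X := ∑ i, c i • x i
    have h1 : Z (X * star X) = kreinInner (d X : K) (d X : K) := by
      rw [G.functional_eq, map_mul]
      exact G.adjoint_eq X G.Ω (d X)
    rw [h1]
    exact norm_kreinInner_self_le _
  · obtain ⟨C, hC⟩ := hG a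
    -- Adding 1 ensures strict positivity, as `C` may be zero.
    refine ⟨C ^ 2 + 1, by positivity, fun n c x => ?_⟩
    rw [hn n c fun i => d (x i * star a), hn n c fun i => d (x i)]
    simp only [hda]
    have h1 : ∑ i, conj (c i) • G.π a (d (x i)) = G.π a (∑ i, conj (c i) • d (x i)) := by
      simp only [map_sum, map_smul]
    rw [h1]
    have h2 := hC (∑ i, conj (c i) • d (x i))
    have h3 := pow_le_pow_left₀ (norm_nonneg _) h2 2
    rw [mul_pow] at h3
    refine h3.trans ?_
    gcongr
    linarith

end Forward

/-! ### From a kernel to bounded GNS data -/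

section Backward

variable {A : Type u} [Ring A] [StarRing A] [Algebra ℂ A] [StarModule ℂ A]

theorem admitsBoundedGNSData_of_kernel (Z : A →ₗ[ℂ] ℂ) (hZ : ∀ a : A, Z (star a) = conj (Z a))
    {L : A → A → ℂ} (hL : IsPosDefKernel L) (hS : SchwartzBound Z L)
    (hC : ∀ a : A, ∃ C : ℝ, 0 < C ∧ ∀ (n : ℕ) (c : Fin n → ℂ) (x : Fin n → A),
        (∑ i, ∑ j, c i * conj (c j) * L (x i * star a) (x j * star a)).re ≤
          C * (∑ i, ∑ j, c i * conj (c j) * L (x i) (x j)).re) :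
    AdmitsBoundedGNSData.{u, v} Z := by
  -- The stars turn `x ↦ xa*` into left multiplication by `a`; `ULift` puts `H` in the required
  -- universe.
  obtain ⟨H, _, _, _, k, hk, hkL⟩ := Matrix.PosSemidef.exists_hilbert
    (hL.submatrix fun x : ULift.{v} A => star x.down)
  -- Since `L` need not be sesquilinear, `k` need not be linear; the free vector space on `A`
  -- replaces `A` until `hker`.
  let e : (ULift.{v} A →₀ ℂ) →ₗ[ℂ] H := Finsupp.linearCombination ℂ k
  let ε : (ULift.{v} A →₀ ℂ) →ₗ[ℂ] A := Finsupp.linearCombination ℂ ULift.down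
  let δ : A → (ULift.{v} A →₀ ℂ) := fun x => Finsupp.single ⟨x⟩ 1
  have hεδ : ∀ x, ε (δ x) = x := fun x => by simp [ε, δ]
  have he : DenseRange e := by
    have h1 : Dense ((LinearMap.range e : Submodule ℂ H) : Set H) := by
      rw [Submodule.dense_iff_topologicalClosure_eq_top, ← hk]
      exact congrArg _ (Finsupp.range_linearCombination ℂ)
    exact h1
  have hnorm : ∀ (n : ℕ) (c : Fin n → ℂ) (x : Fin n → ULift.{v} A),
      ‖∑ i, c i • k (x i)‖ ^ 2 = (∑ i, ∑ j, conj (c i) * conj (conj (c j)) *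
        L (star (x i).down) (star (x j).down)).re := fun n c x => by
    rw [norm_sum_smul_sq_eq_re_sum]
    simp only [hkL, Complex.conj_conj]
    rfl
  let B : (ULift.{v} A →₀ ℂ) →ₗ⋆[ℂ] (ULift.{v} A →₀ ℂ) →ₗ[ℂ] ℂ :=
    LinearMap.mk₂'ₛₗ (starRingEnd ℂ) (RingHom.id ℂ) (fun f g => Z (star (ε f) * ε g))
      (fun f f' g => by simp [add_mul]) (fun c f g => by simp)
      (fun f g g' => by simp [mul_add]) (fun c f g => by simp)
  have hB : ∀ f g, B f g = Z (star (ε f) * ε g) := fun _ _ => rfl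
  have hBe : ∀ f, ‖B f f‖ ≤ ‖e f‖ ^ 2 := by
    intro f
    obtain ⟨n, c, x, rfl⟩ := f.exists_eq_sum_fin_single
    have h1 : e (∑ i, Finsupp.single (x i) (c i)) = ∑ i, c i • k (x i) := by simp [e]
    have h2 : ε (∑ i, Finsupp.single (x i) (c i)) = ∑ i, c i • (x i).down := by simp [ε]
    have h3 := hS n (fun i => conj (c i)) (fun i => star (x i).down)
    rw [sum_smul_mul_star, ← hnorm] at h3
    rw [h1, hB, h2]
    convert h3 using 5
    · simp [star_sum]
    · simp [star_sum]
  obtain ⟨G, hG, hGB⟩ := B.exists_isSelfAdjoint_inner_eq e he hBe fun f g => by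
    rw [hB, hB, ← hZ, star_mul, star_star]
  let t : A → (ULift.{v} A →₀ ℂ) →ₗ[ℂ] (ULift.{v} A →₀ ℂ) := fun a =>
    Finsupp.lmapDomain ℂ ℂ fun x => ⟨a * x.down⟩
  have hεt : ∀ a f, ε (t a f) = a * ε f := by
    intro a f
    obtain ⟨n, c, x, rfl⟩ := f.exists_eq_sum_fin_single
    simp [ε, t, Finset.mul_sum]
  have htδ : ∀ a x, t a (δ x) = δ (a * x) := fun a x => by simp [t, δ]
  have het : ∀ a, ∃ C, ∀ f, ‖(e ∘ₗ t a) f‖ ≤ C * ‖e f‖ := by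
    intro a
    obtain ⟨C, hC0, hCa⟩ := hC a
    refine ⟨√C, fun f => ?_⟩
    refine le_of_sq_le_sq ?_ (by positivity)
    rw [mul_pow, Real.sq_sqrt hC0.le]
    obtain ⟨n, c, x, rfl⟩ := f.exists_eq_sum_fin_single
    have h1 : e (∑ i, Finsupp.single (x i) (c i)) = ∑ i, c i • k (x i) := by simp [e]
    have h2 : (e ∘ₗ t a) (∑ i, Finsupp.single (x i) (c i)) = ∑ i, c i • k ⟨a * (x i).down⟩ := by
      simp [e, t]
    rw [h1, h2, hnorm, hnorm]
    simpa only [star_mul] using hCa n (fun i => conj (c i)) (fun i => star (x i).down)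
  let τ : A → H →L[ℂ] H := fun a => (e ∘ₗ t a).extendOfNorm e
  have hτ : ∀ a f, τ a (e f) = e (t a f) := fun a f => LinearMap.extendOfNorm_eq he (het a) f
  have hGτ : ∀ a, G * τ a = star (τ (star a)) * G := by
    intro a
    refine ContinuousLinearMap.ext fun y => ?_
    refine he.induction_on (p := fun y => (G * τ a) y = (star (τ (star a)) * G) y) y
      (isClosed_eq (by fun_prop) (by fun_prop)) fun g => ?_
    refine he.eq_of_inner_right ℂ fun f => ?_
    rw [mul_apply_eq_comp, mul_apply_eq_comp, ContinuousLinearMap.star_eq_adjoint,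
      ContinuousLinearMap.adjoint_inner_right, hτ, hτ, hGB, hGB, hB, hB, hεt, hεt, star_mul,
      star_star, mul_assoc]
  obtain ⟨K, _, _, _, _, W, hW, hWG, hWb⟩ := exists_kreinSpace_of_isSelfAdjoint hG
  have hWe : DenseRange fun f => W (e f) := hW.comp he W.continuous
  -- The form depends only on `ε f`, so nondegeneracy of the Krein form restores linearity in `A`.
  have hker : ∀ f g, ε f = ε g → W (e f) = W (e g) := by
    intro f g hfg
    rw [← sub_eq_zero, ← map_sub, ← map_sub]
    refine eq_zero_of_kreinInner_eq_zero hWe fun g => ?_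
    rw [hWG, hGB, hB, map_sub, hfg, sub_self, mul_zero, map_zero]
  let w : A →ₗ[ℂ] K :=
    { toFun := fun x => W (e (δ x))
      map_add' := fun x y => by
        rw [← map_add, ← map_add]
        exact hker _ _ (by simp only [map_add, hεδ])
      map_smul' := fun c x => by
        rw [RingHom.id_apply, ← map_smul, ← map_smul]
        exact hker _ _ (by simp only [map_smul, hεδ]) }
  have hw : ∀ x, w x = W (e (δ x)) := fun _ => rfl
  have hwd : DenseRange w := by
    refine hWe.mono ?_
    rintro _ ⟨f, rfl⟩
    exact ⟨ε f, hker _ _ (hεδ _)⟩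
  refine ⟨K, _, _, _, _, exists_gnsData_of_linearMap w hwd (fun x y => ?_) fun a => ?_⟩
  · rw [hw, hw, hWG, hGB, hB, hεδ, hεδ]
  · obtain ⟨C, -, hC'⟩ := hWb (τ a) (τ (star a)) (hGτ a)
    refine ⟨C, fun x => ?_⟩
    rw [hw, hw, ← htδ, ← hτ]
    exact hC' _

end Backward

theorem mainTheorem10 {A : Type u} [Ring A] [StarRing A] [Algebra ℂ A] [StarModule ℂ A]
    (Z : A →ₗ[ℂ] ℂ) (hZ : ∀ a : A, Z (star a) = conj (Z a)) (hZ1 : Z 1 = 1) :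
    AdmitsBoundedGNSData.{u, v} Z ↔
      ∃ L : A → A → ℂ, IsPosDefKernel L ∧ SchwartzBound Z L ∧
        ∀ a : A, ∃ C : ℝ, 0 < C ∧
          ∀ (n : ℕ) (c : Fin n → ℂ) (x : Fin n → A),
            (∑ i, ∑ j, c i * conj (c j) * L (x i * star a) (x j * star a)).re ≤
              C * (∑ i, ∑ j, c i * conj (c j) * L (x i) (x j)).re := by
  constructor
  · rintro ⟨K, _, _, _, _, G, hG⟩
    exact hG.exists_kernel
  · rintro ⟨L, hL, hS, hC⟩
    exact admitsBoundedGNSData_of_kernel Z hZ hL hS hC
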